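/- **Setting.** Let $d\ge m\ge 1$ and $T\ge 1$ be integers, $C\ge 0$, $L\in\mathbb R$, $\alpha>0$, $\sigma\ge 0$. For rounds $t=1,\dots,T$ let $x_t\in\mathbb R^d$ be examples, $\ell_t:\mathbb R\to[0,\infty)$ convex differentiable functions, $f_t(w)=\ell_t(w^\top x_t)$, and let $\sigma_t,\eta_t$ be reals. Put $\mathcal K_t=\{w\in\mathbb R^d: |w^\top x_t|\le C\}$ and $\mathcal K=\bigcap_{t=1}^T\mathcal K_t$. Let $\tau_C(y)=\mathrm{sgn}(y)\max\{|y|-C,0\}$. **The algorithm FD-SON** (Sketched Online Newton with the Frequent Directions sketch of size $m$). Start with $u_1=0\in\mathbb R^d$, $S_0=0\in\mathbb R^{m\times d}$, $H_0=\frac1\alpha I_m$. In rounds $t=1,\dots,T$: 1. (projection) $\gamma_t=\dfrac{\tau_C(u_t^\top x_t)}{x_t^\top x_t-x_t^\top S_{t-1}^\top H_{t-1}S_{t-1}x_t}$ and $w_t=u_t-\gamma_t\,(x_t-S_{t-1}^\top H_{t-1}S_{t-1}x_t)$ (with $\gamma_t=0$ if $x_t=0$); 2. $g_t=\ell_t'(w_t^\top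 x_t)\,x_t$ and $\widehat g_t=\sqrt{\sigma_t+\eta_t}\,g_t$; 3. (sketch update) let $S$ be $S_{t-1}$ with its last row replaced by $\widehat g_t^\top$; take any decomposition $S^\top S=V^\top\Sigma V$ with $V\in\mathbb R^{m\times d}$, $VV^\top=I_m$, and $\Sigma\in\mathbb R^{m\times m}$ diagonal with non-increasing diagonal; set $S_t=(\Sigma-\Sigma_{m,m}I_m)^{1/2}V$ and $H_t=\mathrm{diag}\big(\frac{1}{\alpha+\Sigma_{i,i}-\Sigma_{m,m}}\big)_{i=1}^m$; 4. $u_{t+1}=w_t-\frac1\alpha\,(g_t-S_t^\top H_tS_tg_t)$. (Equivalently, $u_{t+1}=w_t-A_t^{-1}g_t$ with $A_t=\alpha I_d+S_t^\top S_t$.) Let $G_T\in\mathbb R^{T\times d}$ be the matrix with rows $\widehat g_1^\top,\dots,\widehat g_T^\top$, let $\lambda_1\ge\dots\ge\lambda_d$ be the eigenvalues of $G_T^\top G_T$, and $\Omega_k=\sum_{i=k+1}^d\lambda_i$. The regret to $w$ is $R_T(w)=\sum_{t=1}^Tf_t(w_t)-\sum_{t=1}^Tf_t(w)$. **Theorem.**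 Assume that for every $t=1,\dots,T$: * $|\ell_t'(z)|\le L$ whenever $|z|\le C$; * for all $u\in\mathcal K_t$ and $w\in\mathcal K$, $\;f_t(w)\ge f_t(u)+\nabla f_t(u)^\top(w-u)+\frac{\sigma_t}{2}\big(\nabla f_t(u)^\top(u-w)\big)^2$; * $\sigma_t\ge\sigma$ and $\eta_t\ge0$; and that $\eta_1\ge\eta_2\ge\dots\ge\eta_T$ and $\sigma+\eta_T>0$. Then, for every run of FD-SON, every $w\in\mathcal K$ and every $k=0,\dots,m-1$, $$R_T(w)\le\frac\alpha2\|w\|_2^2+2(CL)^2\sum_{t=1}^T\eta_t+\frac{m}{2(\sigma+\eta_T)}\ln\Big(1+\frac{\mathrm{tr}(S_T^\top S_T)}{m\alpha}\Big)+\frac{m\,\Omega_k}{2(m-k)(\sigma+\eta_T)\alpha}.$$ -/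

import Mathlib

open Matrix

noncomputable section

namespace FDSON

/-- The loss `f(w) = ℓ(wᵀx)` of a linear predictor `w` on the example `x`. -/
def linLoss {d : ℕ} (ℓ : ℝ → ℝ) (x : Fin d → ℝ) (w : Fin d → ℝ) : ℝ := ℓ (w ⬝ᵥ x)

/-- The gradient of `f` at `u`, as the vector of partial derivatives. -/
def grad {d : ℕ} (f : (Fin d → ℝ) → ℝ) (u : Fin d → ℝ) : Fin d → ℝ :=
  fun i => fderiv ℝ f u (Pi.single i 1)

/-- `𝒦_t`: the predictors whose prediction on the example `x` is bounded by `C`. -/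
def slab {d : ℕ} (C : ℝ) (x : Fin d → ℝ) : Set (Fin d → ℝ) := {w | |w ⬝ᵥ x| ≤ C}

/-- `𝒦`: the comparators, whose predictions on `x 1, …, x T` are all bounded by `C`. -/
def comparators {d : ℕ} (C : ℝ) (T : ℕ) (x : ℕ → Fin d → ℝ) : Set (Fin d → ℝ) :=
  {w | ∀ t ∈ Finset.Icc 1 T, w ∈ slab C (x t)}

/-- Scalar Lipschitz assumption on a loss function. -/
def ScalarLipschitz (C L : ℝ) (ℓ : ℝ → ℝ) : Prop := ∀ z : ℝ, |z| ≤ C → |deriv ℓ z| ≤ L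

/-- Curvature of `f` with parameter `s`, at the base points `u ∈ U`, against the points `w ∈ W`. -/
def Curvature {d : ℕ} (U W : Set (Fin d → ℝ)) (f : (Fin d → ℝ) → ℝ) (s : ℝ) : Prop :=
  ∀ u ∈ U, ∀ w ∈ W,
    f u + grad f u ⬝ᵥ (w - u) + s / 2 * (grad f u ⬝ᵥ (u - w)) ^ 2 ≤ f w

/-- The sign function with the convention `sgn 0 = 1`. -/
def sgn (a : ℝ) : ℝ := if 0 ≤ a then 1 else -1

/-- `τ_C(y) = sgn(y) max(|y| - C, 0)`. -/
def tau (C y : ℝ) : ℝ := sgn y * max (|y| - C) 0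

/-- The projection step. For `x = 0` the quotient is `0 / 0`, read as `0`, so that `w = u`. -/
def projStep {m d : ℕ} (C : ℝ) (S : Matrix (Fin m) (Fin d) ℝ) (H : Matrix (Fin m) (Fin m) ℝ)
    (x u : Fin d → ℝ) : Fin d → ℝ :=
  let xh : Fin m → ℝ := S *ᵥ x
  let γ : ℝ := tau C (u ⬝ᵥ x) / (x ⬝ᵥ x - xh ⬝ᵥ (H *ᵥ xh))
  u - γ • (x - Sᵀ *ᵥ (H *ᵥ xh))

/-- The last of `m` row indices. -/
def lastRow (m : ℕ) [NeZero m] : Fin m := ⟨m - 1, Nat.sub_lt (NeZero.pos m) Nat.one_pos⟩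

/-- One update of the Frequent Directions sketch `S` by the vector `g`, with results `S'`, `H'`:
`g` replaces the last row of `S`, the new covariance is decomposed as `Vᵀ Σ V` (any such
decomposition is allowed, with orthonormal rows of `V` and eigenvalues `e` in decreasing order),
and `S' = (Σ - Σ_{mm} I)^{1/2} V`. -/
def FDUpdate {m d : ℕ} [NeZero m] (α : ℝ) (S : Matrix (Fin m) (Fin d) ℝ) (g : Fin d → ℝ)
    (S' : Matrix (Fin m) (Fin d) ℝ) (H' : Matrix (Fin m) (Fin m) ℝ) : Prop :=
  ∃ (V : Matrix (Fin m) (Fin d) ℝ) (e : Fin m → ℝ),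
    V * Vᵀ = 1 ∧ Antitone e ∧
    Vᵀ * Matrix.diagonal e * V =
      (S.updateRow (lastRow m) g)ᵀ * S.updateRow (lastRow m) g ∧
    S' = Matrix.diagonal (fun i => Real.sqrt (e i - e (lastRow m))) * V ∧
    H' = Matrix.diagonal (fun i => 1 / (α + e i - e (lastRow m)))

/-- The gradient `g_t = ℓ_t'(w_tᵀx_t) x_t` observed in round `t`. -/
def roundGrad {d : ℕ} (x : ℕ → Fin d → ℝ) (ℓ : ℕ → ℝ → ℝ) (w : ℕ → Fin d → ℝ) (t : ℕ) :
    Fin d → ℝ :=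
  deriv (ℓ t) (w t ⬝ᵥ x t) • x t

/-- The to-sketch vector `√(σ_t + η_t) g_t` of round `t`. -/
def toSketch {d : ℕ} (x : ℕ → Fin d → ℝ) (ℓ : ℕ → ℝ → ℝ) (σs η : ℕ → ℝ) (w : ℕ → Fin d → ℝ)
    (t : ℕ) : Fin d → ℝ :=
  Real.sqrt (σs t + η t) • roundGrad x ℓ w t

/-- `(u, w, S, H)` is a run of FD-SON over the rounds `1, …, T` on the examples `x t` and the losses
`ℓ t`: `S t`, `H t` are the sketch and its companion after round `t`, `w t` is the prediction vector
of round `t`. -/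
structure IsRun {m d : ℕ} [NeZero m] (T : ℕ) (C α : ℝ) (x : ℕ → Fin d → ℝ) (ℓ : ℕ → ℝ → ℝ)
    (σs η : ℕ → ℝ) (u w : ℕ → Fin d → ℝ) (S : ℕ → Matrix (Fin m) (Fin d) ℝ)
    (H : ℕ → Matrix (Fin m) (Fin m) ℝ) : Prop where
  init_u : u 1 = 0
  init_S : S 0 = 0
  init_H : H 0 = (1 / α) • (1 : Matrix (Fin m) (Fin m) ℝ)
  proj : ∀ t < T, w (t + 1) = projStep C (S t) (H t) (x (t + 1)) (u (t + 1))
  sketch : ∀ t < T, FDUpdate α (S t) (toSketch x ℓ σs η w (t + 1)) (S (t + 1)) (H (t + 1))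
  weight : ∀ t < T, u (t + 2) = w (t + 1) - (1 / α) •
    (roundGrad x ℓ w (t + 1) -
      (S (t + 1))ᵀ *ᵥ (H (t + 1) *ᵥ (S (t + 1) *ᵥ roundGrad x ℓ w (t + 1))))

/-- The regret of the predictors `w 1, …, w T` to the comparator `v`. -/
def regret {d : ℕ} (T : ℕ) (x : ℕ → Fin d → ℝ) (ℓ : ℕ → ℝ → ℝ) (w : ℕ → Fin d → ℝ)
    (v : Fin d → ℝ) : ℝ :=
  ∑ t ∈ Finset.Icc 1 T, linLoss (ℓ t) (x t) (w t) - ∑ t ∈ Finset.Icc 1 T, linLoss (ℓ t) (x t) v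

/-- The matrix `G_T` whose `t`-th row, `t = 1, …, T`, is the to-sketch vector of round `t`. -/
def gradMatrix {d : ℕ} (T : ℕ) (x : ℕ → Fin d → ℝ) (ℓ : ℕ → ℝ → ℝ) (σs η : ℕ → ℝ)
    (w : ℕ → Fin d → ℝ) : Matrix (Fin T) (Fin d) ℝ :=
  Matrix.of fun t => toSketch x ℓ σs η w (t + 1)

theorem gram_isHermitian {n d : ℕ} (G : Matrix (Fin n) (Fin d) ℝ) : (Gᵀ * G).IsHermitian := by
  simpa using Matrix.isHermitian_conjTranspose_mul_self G

/-- The sum of the eigenvalues of `GᵀG` (with multiplicity, in decreasing order) beyond the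
`k`-th one; Mathlib's `eigenvalues₀` are in decreasing order and numbered from `0`. -/
def tailEigs {n d : ℕ} (G : Matrix (Fin n) (Fin d) ℝ) (k : ℕ) : ℝ :=
  ∑ i with k ≤ i.val, (gram_isHermitian G).eigenvalues₀ i

end FDSON

end

noncomputable section

namespace FDSON

/-! With `A_t = αI + S_tᵀS_t`, the potential is the squared `A_t`-distance from `u_{t+1}` to the
comparator `v`. The projection does not increase it (`projStep_quadForm_le`), and expanding the
Newton step turns `2 gᵀ(w - v)` into a drop of potential plus `gᵀA_t⁻¹g`. Since `A_t ≤ A_{t-1} +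
(σ_t + η_t) g gᵀ`, changing the norm costs a `σ_t` part, cancelled by curvature, and an `η_t` part
of at most `4(CL)²η_t` (`two_mul_sub_le`).

The sketch satisfies `S_tᵀS_t + ρ_t V_tᵀV_t = S_{t-1}ᵀS_{t-1} + ĝ_t ĝ_tᵀ` (`IsSketch.update`).
Concavity of `log det` therefore bounds `ĝ_tᵀA_t⁻¹ĝ_t` by the increase of `log det A_t` plus
`mρ_t/α`. The first part telescopes to an `m`-dimensional determinant (`log_det_precond_le`). For
the second, `∑ ρ_t V_tᵀV_t ≤ GᵀG`, tested on the eigenvectors of `GᵀG` beyond the `k`-th, gives `(m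
- k) ∑ ρ_t ≤ Ω_k` (`sum_shrinkage_mul_le_tailEigs`). -/

theorem grad_linLoss {d : ℕ} {ℓ : ℝ → ℝ} (hℓ : Differentiable ℝ ℓ) (x u : Fin d → ℝ) :
    grad (linLoss ℓ x) u = deriv ℓ (u ⬝ᵥ x) • x := by
  have hlin : HasFDerivAt (fun w : Fin d → ℝ => w ⬝ᵥ x)
      (LinearMap.toContinuousLinearMap (dotProductBilin ℝ ℝ x)) u := by
    have h := (LinearMap.toContinuousLinearMap (dotProductBilin ℝ ℝ x)).hasFDerivAt (x := u)
    refine h.congr_of_eventuallyEq (Filter.Eventually.of_forall fun w => ?_)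
    simp [dotProduct_comm]
  have h := (hℓ (u ⬝ᵥ x)).hasDerivAt.comp_hasFDerivAt u hlin
  ext i
  change fderiv ℝ (ℓ ∘ fun w : Fin d → ℝ => w ⬝ᵥ x) u (Pi.single i 1) = _
  rw [h.fderiv]
  simp

/-! ### Algebra of the sketched preconditioner -/

/-- A sketch with orthogonal rows, the last of which vanishes, and its companion matrix. -/
def IsSketch {m d : ℕ} [NeZero m] (α : ℝ) (S : Matrix (Fin m) (Fin d) ℝ)
    (H : Matrix (Fin m) (Fin m) ℝ) : Prop :=
  ∃ D : Fin m → ℝ, (∀ i, 0 ≤ D i) ∧ D (lastRow m) = 0 ∧ S * Sᵀ = diagonal D ∧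
    H = diagonal fun i => 1 / (α + D i)

/-- The preconditioner `αI + SᵀS`. -/
def precond {m d : ℕ} (α : ℝ) (S : Matrix (Fin m) (Fin d) ℝ) : Matrix (Fin d) (Fin d) ℝ :=
  α • (1 : Matrix (Fin d) (Fin d) ℝ) + Sᵀ * S

/-- The Woodbury form of the inverse of the preconditioner. -/
def precondInv {m d : ℕ} (α : ℝ) (S : Matrix (Fin m) (Fin d) ℝ) (H : Matrix (Fin m) (Fin m) ℝ) :
    Matrix (Fin d) (Fin d) ℝ :=
  (1 / α) • (1 - Sᵀ * H * S)

section

variable {m d : ℕ} {α : ℝ} {S : Matrix (Fin m) (Fin d) ℝ} {H : Matrix (Fin m) (Fin m) ℝ}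

theorem precond_transpose : (precond α S)ᵀ = precond α S := by
  simp [precond]

theorem dotProduct_precond_mulVec (y : Fin d → ℝ) :
    y ⬝ᵥ (precond α S *ᵥ y) = α * (y ⬝ᵥ y) + (S *ᵥ y) ⬝ᵥ (S *ᵥ y) := by
  simp only [precond, add_mulVec, smul_mulVec, one_mulVec, dotProduct_add, dotProduct_smul,
    smul_eq_mul, ← mulVec_mulVec]
  rw [dotProduct_mulVec y, vecMul_transpose]

theorem precond_posDef (hα : 0 < α) : (precond α S).PosDef := by
  refine Matrix.PosDef.of_dotProduct_mulVec_pos ?_ fun y hy => ?_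
  · rw [Matrix.IsHermitian, conjTranspose_eq_transpose_of_trivial, precond_transpose]
  · rw [star_trivial, dotProduct_precond_mulVec]
    have h1 : 0 < y ⬝ᵥ y := by
      simpa using (dotProduct_star_self_pos_iff (v := y)).2 hy
    have h2 : 0 ≤ (S *ᵥ y) ⬝ᵥ (S *ᵥ y) := by
      simpa using dotProduct_star_self_nonneg (S *ᵥ y)
    positivity

theorem precondInv_mulVec (g : Fin d → ℝ) :
    precondInv α S H *ᵥ g = (1 / α) • (g - Sᵀ *ᵥ (H *ᵥ (S *ᵥ g))) := by
  simp [precondInv, smul_mulVec, sub_mulVec, mulVec_mulVec, Matrix.mul_assoc]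

/-- The factor `α` relating the algorithm's quantities to the inverse preconditioner cancels between
the step length and the direction. -/
theorem projStep_eq (hα : 0 < α) (C : ℝ) (x u : Fin d → ℝ) :
    projStep C S H x u =
      u - (tau C (u ⬝ᵥ x) / (x ⬝ᵥ (precondInv α S H *ᵥ x))) • (precondInv α S H *ᵥ x) := by
  have h : x ⬝ᵥ x - (S *ᵥ x) ⬝ᵥ (H *ᵥ (S *ᵥ x)) = α * (x ⬝ᵥ (precondInv α S H *ᵥ x)) := by
    rw [precondInv_mulVec, dotProduct_smul, dotProduct_sub, dotProduct_mulVec x, vecMul_transpose,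
      smul_eq_mul]
    field_simp
  simp only [projStep, h]
  congr 1
  generalize x ⬝ᵥ (precondInv α S H *ᵥ x) = q
  rw [precondInv_mulVec, smul_smul]
  congr 1
  rw [mul_comm α q, ← div_div]
  ring

theorem dotProduct_mulVec_gram {n : ℕ} (M : Matrix (Fin n) (Fin d) ℝ) (y : Fin d → ℝ) :
    y ⬝ᵥ ((Mᵀ * M) *ᵥ y) = (M *ᵥ y) ⬝ᵥ (M *ᵥ y) := by
  rw [← mulVec_mulVec, dotProduct_mulVec, vecMul_transpose]

theorem real_dotProduct_self_nonneg {n : ℕ} (y : Fin n → ℝ) : 0 ≤ y ⬝ᵥ y :=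
  Finset.sum_nonneg fun _ _ => mul_self_nonneg _

/-- Bessel's inequality: `VᵀV` is an orthogonal projection, so the squared length of `y - VᵀVy` is
the difference of the two sides. -/
theorem mulVec_dotProduct_self_le {V : Matrix (Fin m) (Fin d) ℝ} (hV : V * Vᵀ = 1)
    (y : Fin d → ℝ) : (V *ᵥ y) ⬝ᵥ (V *ᵥ y) ≤ y ⬝ᵥ y := by
  have h := real_dotProduct_self_nonneg (y - (Vᵀ * V) *ᵥ y)
  have h1 : ((Vᵀ * V) *ᵥ y) ⬝ᵥ ((Vᵀ * V) *ᵥ y) = (V *ᵥ y) ⬝ᵥ (V *ᵥ y) := by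
    rw [← mulVec_mulVec, mulVec_transpose, ← dotProduct_mulVec, ← mulVec_transpose,
      mulVec_mulVec _ V Vᵀ, hV, one_mulVec]
  rw [sub_dotProduct, dotProduct_sub, dotProduct_sub, h1, dotProduct_comm ((Vᵀ * V) *ᵥ y) y,
    dotProduct_mulVec_gram] at h
  linarith

variable [NeZero m]

theorem IsSketch.precond_mul_precondInv (h : IsSketch α S H) (hα : 0 < α) :
    precond α S * precondInv α S H = 1 := by
  obtain ⟨D, hD, -, hS, rfl⟩ := h
  set K : Matrix (Fin m) (Fin m) ℝ := diagonal fun i => 1 / (α + D i) with hK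
  -- The companion matrix inverts `αI + SSᵀ`, which is diagonal; sandwiching this between `Sᵀ` and
  -- `S` gives the Woodbury identity.
  have h1 : α • K + diagonal D * K = 1 := by
    rw [hK, diagonal_mul_diagonal, ← diagonal_smul, diagonal_add, ← diagonal_one]
    congr 1
    ext i
    have := hD i
    have : α + D i ≠ 0 := by positivity
    simp
    field_simp
  have h2 : Sᵀ * S * (Sᵀ * K * S) = Sᵀ * (diagonal D * K) * S := by
    rw [← hS]
    simp only [Matrix.mul_assoc]
  have h3 : Sᵀ * (α • K + diagonal D * K) * S = Sᵀ * S := by rw [h1, Matrix.mul_one]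
  rw [Matrix.mul_add, Matrix.add_mul, Matrix.mul_smul, Matrix.smul_mul] at h3
  rw [precond, precondInv, Matrix.mul_smul, Matrix.add_mul, Matrix.mul_sub, Matrix.mul_sub, h2,
    Matrix.mul_one, Matrix.mul_one, Matrix.smul_mul, Matrix.one_mul]
  have h4 : α • (1 : Matrix (Fin d) (Fin d) ℝ) - α • (Sᵀ * K * S)
      + (Sᵀ * S - Sᵀ * (diagonal D * K) * S) = α • 1 := by
    rw [← h3]; abel
  rw [h4, smul_smul, one_div, inv_mul_cancel₀ hα.ne', one_smul]

theorem IsSketch.dotProduct_precondInv_le (h : IsSketch α S H) (hα : 0 < α) (y : Fin d → ℝ) :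
    y ⬝ᵥ (precondInv α S H *ᵥ y) ≤ (y ⬝ᵥ y) / α := by
  obtain ⟨D, hD, -, -, rfl⟩ := h
  rw [precondInv_mulVec, dotProduct_smul, dotProduct_sub, dotProduct_mulVec y, vecMul_transpose,
    smul_eq_mul, one_div, inv_mul_eq_div]
  have : 0 ≤ (S *ᵥ y) ⬝ᵥ ((diagonal fun i => 1 / (α + D i)) *ᵥ (S *ᵥ y)) := by
    refine Finset.sum_nonneg fun i _ => ?_
    rw [mulVec_diagonal, mul_left_comm]
    have := hD i
    exact mul_nonneg (by positivity) (mul_self_nonneg _)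
  gcongr
  linarith

theorem IsSketch.mulVec_precondInv_mulVec (h : IsSketch α S H) (hα : 0 < α) (g : Fin d → ℝ) :
    precond α S *ᵥ (precondInv α S H *ᵥ g) = g := by
  rw [mulVec_mulVec, h.precond_mul_precondInv hα, one_mulVec]

/-- Effect of a preconditioned gradient step on the preconditioner norm. -/
theorem IsSketch.quadForm_sub (h : IsSketch α S H) (hα : 0 < α) (c : ℝ) (g y : Fin d → ℝ) :
    (y - c • (precondInv α S H *ᵥ g)) ⬝ᵥ (precond α S *ᵥ (y - c • (precondInv α S H *ᵥ g))) =
      y ⬝ᵥ (precond α S *ᵥ y) - 2 * c * (g ⬝ᵥ y) + c ^ 2 * (g ⬝ᵥ (precondInv α S H *ᵥ g)) := by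
  have h1 := h.mulVec_precondInv_mulVec hα g
  set n := precondInv α S H *ᵥ g
  have h2 : n ⬝ᵥ (precond α S *ᵥ y) = g ⬝ᵥ y := by
    rw [dotProduct_mulVec, ← mulVec_transpose, precond_transpose, h1]
  simp only [mulVec_sub, mulVec_smul, sub_dotProduct, dotProduct_sub, smul_dotProduct,
    dotProduct_smul, h1, h2, smul_eq_mul, dotProduct_comm y g, dotProduct_comm n g]
  ring

theorem IsSketch.dotProduct_precondInv_pos (h : IsSketch α S H) (hα : 0 < α) {g : Fin d → ℝ}
    (hg : g ≠ 0) : 0 < g ⬝ᵥ (precondInv α S H *ᵥ g) := by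
  have h1 := h.mulVec_precondInv_mulVec hα g
  set n := precondInv α S H *ᵥ g
  have hn : n ≠ 0 := by
    rintro hn
    rw [hn, mulVec_zero] at h1
    exact hg h1.symm
  have := (precond_posDef (S := S) hα).dotProduct_mulVec_pos hn
  rwa [h1, star_trivial, dotProduct_comm] at this

/-! ### Projection onto a slab -/

theorem abs_sub_tau_le {C : ℝ} (hC : 0 ≤ C) (y : ℝ) : |y - tau C y| ≤ C := by
  unfold tau sgn
  rw [abs_le]
  split_ifs with h
  · rw [abs_of_nonneg h]
    constructor <;> cases max_cases (y - C) 0 <;> linarith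
  · rw [abs_of_neg (not_le.1 h)]
    constructor <;> cases max_cases (-y - C) 0 <;> linarith

/-- This is `(y - τ - z)² ≤ (y - z)²` with `τ = tau C y`: clipping `y` to `[-C, C]` brings it no
farther from a point `z` of that interval. -/
theorem tau_mul_nonneg {C z : ℝ} (hz : |z| ≤ C) (y : ℝ) :
    0 ≤ tau C y * (2 * (y - z) - tau C y) := by
  unfold tau sgn
  rw [abs_le] at hz
  split_ifs with h
  · rw [abs_of_nonneg h]
    rcases max_cases (y - C) 0 with ⟨h1, h2⟩ | ⟨h1, h2⟩ <;> rw [h1]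
    · apply mul_nonneg <;> linarith
    · simp
  · rw [abs_of_neg (not_le.1 h)]
    rcases max_cases (-y - C) 0 with ⟨h1, h2⟩ | ⟨h1, h2⟩ <;> rw [h1]
    · apply mul_nonneg_of_nonpos_of_nonpos <;> linarith
    · simp

theorem IsSketch.projStep_mem_slab (h : IsSketch α S H) (hα : 0 < α) {C : ℝ} (hC : 0 ≤ C)
    (x u : Fin d → ℝ) : projStep C S H x u ∈ slab C x := by
  by_cases hx : x = 0
  · simp [slab, hx, hC]
  · have hq := h.dotProduct_precondInv_pos hα hx
    rw [slab, Set.mem_ofPred_eq, projStep_eq hα, sub_dotProduct, smul_dotProduct, smul_eq_mul,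
      dotProduct_comm _ x, dotProduct_comm _ x, div_mul_cancel₀ _ hq.ne']
    exact abs_sub_tau_le hC _

theorem IsSketch.projStep_quadForm_le (h : IsSketch α S H) (hα : 0 < α) {C : ℝ}
    {x v : Fin d → ℝ} (hv : v ∈ slab C x) (u : Fin d → ℝ) :
    (projStep C S H x u - v) ⬝ᵥ (precond α S *ᵥ (projStep C S H x u - v)) ≤
      (u - v) ⬝ᵥ (precond α S *ᵥ (u - v)) := by
  rw [projStep_eq hα, sub_right_comm, h.quadForm_sub hα, dotProduct_comm x (u - v)]
  by_cases hx : x = 0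
  · simp [hx]
  · have hq := h.dotProduct_precondInv_pos hα hx
    generalize x ⬝ᵥ (precondInv α S H *ᵥ x) = q at hq
    have h1 := tau_mul_nonneg hv (u ⬝ᵥ x)
    rw [sub_dotProduct u v x]
    generalize tau C (u ⬝ᵥ x) = τ at h1
    -- The drop in squared distance is the scalar clipping gain divided by `xᵀA⁻¹x`.
    have h2 : 2 * (τ / q) * (u ⬝ᵥ x - v ⬝ᵥ x) - (τ / q) ^ 2 * q =
        τ * (2 * (u ⬝ᵥ x - v ⬝ᵥ x) - τ) / q := by
      field_simp
    have h3 := div_nonneg h1 hq.le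
    linarith

/-! ### The Frequent Directions update -/

theorem isSketch_zero : IsSketch α (0 : Matrix (Fin m) (Fin d) ℝ) ((1 / α) • 1) :=
  ⟨0, fun _ => le_rfl, rfl, by simp, by simp [smul_one_eq_diagonal]⟩

theorem IsSketch.lastRow_eq_zero (h : IsSketch α S H) : S (lastRow m) = 0 := by
  obtain ⟨D, -, h0, hS, -⟩ := h
  have h1 := congrFun (congrFun hS (lastRow m)) (lastRow m)
  rw [diagonal_apply_eq, h0] at h1
  have h2 : S (lastRow m) ⬝ᵥ S (lastRow m) = 0 := h1
  exact dotProduct_self_eq_zero.1 h2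

/-- The overwritten last row is zero, so nothing is lost from the covariance. -/
theorem IsSketch.updateRow_gram (h : IsSketch α S H) (g : Fin d → ℝ) :
    (S.updateRow (lastRow m) g)ᵀ * S.updateRow (lastRow m) g = Sᵀ * S + vecMulVec g g := by
  have h0 := h.lastRow_eq_zero
  ext i j
  rw [Matrix.add_apply, mul_apply, mul_apply, vecMulVec_apply,
    ← Finset.add_sum_erase _ _ (Finset.mem_univ (lastRow m)),
    ← Finset.add_sum_erase Finset.univ (fun l => Sᵀ i l * S l j) (Finset.mem_univ (lastRow m))]
  have h1 : Sᵀ i (lastRow m) * S (lastRow m) j = 0 := by simp [h0]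
  rw [h1, zero_add, add_comm]
  congr 1
  · refine Finset.sum_congr rfl fun l hl => ?_
    simp [updateRow_ne (Finset.ne_of_mem_erase hl)]
  · simp

/-- The shrinkage `ρ` is the smallest retained eigenvalue: subtracting it from all `m` eigenvalues
removes `ρ VᵀV` and empties the last row again. -/
theorem IsSketch.update (h : IsSketch α S H) {g : Fin d → ℝ} {S' : Matrix (Fin m) (Fin d) ℝ}
    {H' : Matrix (Fin m) (Fin m) ℝ} (hu : FDUpdate α S g S' H') :
    IsSketch α S' H' ∧ ∃ (V : Matrix (Fin m) (Fin d) ℝ) (ρ : ℝ), V * Vᵀ = 1 ∧ 0 ≤ ρ ∧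
      S'ᵀ * S' + ρ • (Vᵀ * V) = Sᵀ * S + vecMulVec g g := by
  obtain ⟨V, e, hV, he, hdec, rfl, rfl⟩ := hu
  have hlast : ∀ i, i ≤ lastRow m := fun i => by
    rw [Fin.le_def]
    have := i.2
    simp only [lastRow]
    omega
  have hD : ∀ i, 0 ≤ e i - e (lastRow m) := fun i => sub_nonneg.2 (he (hlast i))
  have hsq : ∀ i, √(e i - e (lastRow m)) * √(e i - e (lastRow m)) = e i - e (lastRow m) :=
    fun i => Real.mul_self_sqrt (hD i)
  refine ⟨⟨fun i => e i - e (lastRow m), hD, sub_self _, ?_, ?_⟩, V, e (lastRow m), hV, ?_, ?_⟩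
  · rw [transpose_mul, diagonal_transpose, Matrix.mul_assoc, ← Matrix.mul_assoc V, hV,
      Matrix.one_mul, diagonal_mul_diagonal]
    simp only [hsq]
  · simp only [add_sub_assoc]
  · set M := S.updateRow (lastRow m) g
    -- The eigenvalues are diagonal entries of a Gram matrix, hence nonnegative.
    have h1 : diagonal e = (M * Vᵀ)ᵀ * (M * Vᵀ) := by
      rw [transpose_mul, transpose_transpose, Matrix.mul_assoc, ← Matrix.mul_assoc Mᵀ, ← hdec]
      simp only [Matrix.mul_assoc, hV, Matrix.mul_one]
      rw [← Matrix.mul_assoc, hV, Matrix.one_mul]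
    have h2 := congrFun (congrFun h1 (lastRow m)) (lastRow m)
    rw [diagonal_apply_eq, mul_apply] at h2
    rw [h2]
    exact Finset.sum_nonneg fun i _ => mul_self_nonneg _
  · rw [← h.updateRow_gram g, ← hdec, transpose_mul, diagonal_transpose, Matrix.mul_assoc,
      ← Matrix.mul_assoc (diagonal _), diagonal_mul_diagonal]
    simp only [hsq]
    have h1 : diagonal e = diagonal (fun i => e i - e (lastRow m)) + e (lastRow m) • 1 := by
      rw [smul_one_eq_diagonal, diagonal_add]
      simp
    conv_rhs => rw [h1]
    simp [Matrix.mul_add, Matrix.add_mul, Matrix.mul_assoc]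

end

/-! ### Log-determinant bounds -/

/-- Sum `log λ ≤ λ - 1` over the eigenvalues. -/
theorem log_det_le_trace_sub {n : ℕ} {P : Matrix (Fin n) (Fin n) ℝ} (hP : P.PosDef) :
    Real.log P.det ≤ P.trace - n := by
  have hdet := hP.1.det_eq_prod_eigenvalues
  have htr := hP.1.trace_eq_sum_eigenvalues
  simp only [RCLike.ofReal_real_eq_id, id] at hdet htr
  rw [hdet, htr, Real.log_prod fun i _ => (hP.eigenvalues_pos i).ne']
  have := Finset.sum_le_sum fun i (_ : i ∈ Finset.univ) =>
    Real.log_le_sub_one_of_pos (hP.eigenvalues_pos i)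
  simpa using this

open scoped MatrixOrder in
/-- Concavity of `log det`. -/
theorem trace_mul_sub_le_log_det {n : ℕ} {A B N : Matrix (Fin n) (Fin n) ℝ} (hA : A.PosDef)
    (hB : B.PosDef) (hN : A * N = 1) :
    (N * (A - B)).trace ≤ Real.log A.det - Real.log B.det := by
  have hNA : N = A⁻¹ := (inv_eq_right_inv hN).symm
  have hNpos : N.PosDef := hNA ▸ hA.inv
  -- Writing `B = KᴴK` replaces the non-symmetric `A⁻¹B` by the positive definite `K A⁻¹ Kᴴ`, with
  -- the same trace and determinant.
  obtain ⟨K, hK⟩ := CStarAlgebra.nonneg_iff_eq_star_mul_self.1 hB.posSemidef.nonneg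
  rw [star_eq_conjTranspose] at hK
  have hKu : IsUnit K := by
    have h1 := hB.det_pos.ne'
    rw [hK, det_mul] at h1
    exact (isUnit_iff_isUnit_det K).2 (right_ne_zero_of_mul h1).isUnit
  have hP : (K * N * Kᴴ).PosDef := by
    exact hNpos.mul_mul_conjTranspose_same (Matrix.vecMul_injective_of_isUnit hKu)
  have h := log_det_le_trace_sub hP
  have htr : (K * N * Kᴴ).trace = (N * B).trace := by
    rw [Matrix.trace_mul_comm, ← Matrix.mul_assoc, ← hK, Matrix.trace_mul_comm]
  have hdet : (K * N * Kᴴ).det = B.det / A.det := by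
    have h1 : A.det * N.det = 1 := by rw [← det_mul, hN, det_one]
    rw [hK, det_mul, det_mul, det_mul, eq_div_iff hA.det_pos.ne']
    linear_combination K.det * Kᴴ.det * h1
  rw [htr, hdet, Real.log_div hB.det_pos.ne' hA.det_pos.ne'] at h
  have h2 : (N * A).trace = n := by
    rw [Matrix.trace_mul_comm, hN, trace_one, Fintype.card_fin]
  rw [Matrix.mul_sub, trace_sub, h2]
  linarith

/-- Sylvester's identity moves the determinant to the diagonal `m × m` Gram matrix `SSᵀ`; concavity
of `log` then replaces the factors by their mean. -/
theorem IsSketch.log_det_precond_le {m d : ℕ} [NeZero m] {α : ℝ} {S : Matrix (Fin m) (Fin d) ℝ}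
    {H : Matrix (Fin m) (Fin m) ℝ} (h : IsSketch α S H) (hα : 0 < α) :
    Real.log (precond α S).det - Real.log (precond α (0 : Matrix (Fin m) (Fin d) ℝ)).det ≤
      m * Real.log (1 + (Sᵀ * S).trace / (m * α)) := by
  obtain ⟨D, hD, -, hS, -⟩ := h
  have hm : (0 : ℝ) < m := by exact_mod_cast NeZero.pos m
  have htr : (Sᵀ * S).trace = ∑ i, D i := by rw [trace_mul_comm, hS, trace_diagonal]
  have hdet0 : (precond α (0 : Matrix (Fin m) (Fin d) ℝ)).det = α ^ d := by simp [precond]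
  have hpos : ∀ i, 0 < 1 + D i / α := fun i => by
    have := hD i
    positivity
  have hdet : (precond α S).det = α ^ d * ∏ i, (1 + D i / α) := by
    have h1 : precond α S = α • (1 + (α⁻¹ • Sᵀ) * S) := by
      rw [smul_add, Matrix.smul_mul, smul_smul, mul_inv_cancel₀ hα.ne', one_smul, precond]
    rw [h1, det_smul, Fintype.card_fin, det_one_add_mul_comm, Matrix.mul_smul, hS,
      ← diagonal_smul, ← diagonal_one, diagonal_add, det_diagonal]
    simp [div_eq_inv_mul]
  rw [hdet0, hdet, Real.log_mul (by positivity) (Finset.prod_ne_zero_iff.2 fun i _ => (hpos i).ne'),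
    Real.log_prod fun i _ => (hpos i).ne', htr, add_sub_cancel_left]
  have hsum : 0 ≤ ∑ i, D i := Finset.sum_nonneg fun i _ => hD i
  set b := 1 + (∑ i, D i) / (m * α) with hb
  have hbpos : 0 < b := by positivity
  -- Tangent line of `log` at the mean `b`; the linear terms sum to zero.
  have h1 : ∀ i, Real.log (1 + D i / α) ≤ Real.log b + ((1 + D i / α) / b - 1) := fun i => by
    have := Real.log_le_sub_one_of_pos (div_pos (hpos i) hbpos)
    rw [Real.log_div (hpos i).ne' hbpos.ne'] at this
    linarith
  refine (Finset.sum_le_sum fun i _ => h1 i).trans_eq ?_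
  have h2 : ∑ i, (1 + D i / α) = m * b := by
    rw [Finset.sum_add_distrib, ← Finset.sum_div, hb]
    simp
    field_simp
  rw [Finset.sum_add_distrib, Finset.sum_sub_distrib, ← Finset.sum_div, h2]
  simp
  field_simp
  simp

/-! ### Total shrinkage and the spectral tail -/

/-- Mass captured by the `V`-projections of an orthonormal family, beyond the first `k`. -/
theorem le_sum_mulVec_tail {m d : ℕ} {V : Matrix (Fin m) (Fin d) ℝ} (hV : V * Vᵀ = 1)
    {n : ℕ} (p : Fin n → Fin d → ℝ) (hp : ∀ i, p i ⬝ᵥ p i = 1)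
    (hpp : (of p)ᵀ * of p = 1) (k : ℕ) :
    (m : ℝ) - k ≤ ∑ i with k ≤ i.val, (V *ᵥ p i) ⬝ᵥ (V *ᵥ p i) := by
  -- The total mass is `tr(VᵀV) = m`, and by Bessel each of the at most `k` leading vectors carries
  -- at most `1`.
  have htot : ∑ i, (V *ᵥ p i) ⬝ᵥ (V *ᵥ p i) = m := by
    have h1 : ((V * (of p)ᵀ)ᵀ * (V * (of p)ᵀ)).trace = m := by
      rw [trace_mul_comm, transpose_mul, transpose_transpose, Matrix.mul_assoc,
        ← Matrix.mul_assoc _ _ Vᵀ, hpp, Matrix.one_mul, hV, trace_one, Fintype.card_fin]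
    rw [← h1]
    rfl
  have hsplit := Finset.sum_filter_add_sum_filter_not Finset.univ (fun i : Fin n => k ≤ i.val)
    fun i => (V *ᵥ p i) ⬝ᵥ (V *ᵥ p i)
  have hle : ∑ i with ¬ k ≤ i.val, (V *ᵥ p i) ⬝ᵥ (V *ᵥ p i) ≤ k := by
    calc ∑ i : Fin n with ¬ k ≤ i.val, (V *ᵥ p i) ⬝ᵥ (V *ᵥ p i)
        ≤ ∑ i : Fin n with ¬ k ≤ i.val, (1 : ℝ) :=
          Finset.sum_le_sum fun i _ => (mulVec_dotProduct_self_le hV _).trans_eq (hp i)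
      _ = (Finset.univ.filter fun i : Fin n => ¬ k ≤ i.val).card := by simp
      _ ≤ k := by
          have := Finset.card_le_card_of_injOn (s := Finset.univ.filter fun i : Fin n => ¬ k ≤ i.val)
            (t := Finset.range k) Fin.val (fun i hi => by simpa using hi)
            Fin.val_injective.injOn
          rw [Finset.card_range] at this
          exact_mod_cast this
  linarith

/-- An orthonormal eigenbasis of `GᵀG` in the order of `eigenvalues₀`. -/
theorem exists_eigenbasis_gram {n d : ℕ} (G : Matrix (Fin n) (Fin d) ℝ) :
    ∃ p : Fin (Fintype.card (Fin d)) → Fin d → ℝ, (∀ i, p i ⬝ᵥ p i = 1) ∧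
      (of p)ᵀ * of p = 1 ∧
      ∀ i, (G *ᵥ p i) ⬝ᵥ (G *ᵥ p i) = (gram_isHermitian G).eigenvalues₀ i := by
  set hG := gram_isHermitian G
  -- The same reindexing by which `eigenvalues` is defined from `eigenvalues₀`, so `q.symm` restores
  -- the decreasing order.
  let q : Fin d ≃ Fin (Fintype.card (Fin d)) :=
    (Fintype.equivOfCardEq (Fintype.card_fin _)).symm
  have hnorm : ∀ j, (hG.eigenvectorBasis j).ofLp ⬝ᵥ (hG.eigenvectorBasis j).ofLp = 1 := fun j => by
    have := hG.eigenvectorBasis.inner_eq_one j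
    rw [EuclideanSpace.inner_eq_star_dotProduct] at this
    simpa using this
  have hU : (hG.eigenvectorUnitary : Matrix (Fin d) (Fin d) ℝ) *
      (hG.eigenvectorUnitary : Matrix (Fin d) (Fin d) ℝ)ᵀ = 1 := by
    have := Unitary.mul_star_self_of_mem hG.eigenvectorUnitary.2
    rwa [star_eq_conjTranspose, conjTranspose_eq_transpose_of_trivial] at this
  refine ⟨fun i => hG.eigenvectorBasis (q.symm i), fun i => hnorm _, ?_, fun i => ?_⟩
  · ext a b
    rw [← hU, mul_apply, mul_apply]
    exact Equiv.sum_comp q.symm fun j => hG.eigenvectorBasis j a * hG.eigenvectorBasis j b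
  · rw [← dotProduct_mulVec_gram, hG.mulVec_eigenvectorBasis, dotProduct_smul, hnorm]
    simp [IsHermitian.eigenvalues, q]

theorem sum_Icc_one_eq_sum_range (f : ℕ → ℝ) (T : ℕ) :
    ∑ t ∈ Finset.Icc 1 T, f t = ∑ t ∈ Finset.range T, f (t + 1) := by
  induction T with
  | zero => simp
  | succ T ih => rw [Finset.sum_Icc_succ_top (by omega), ih, Finset.sum_range_succ]

theorem dotProduct_vecMulVec_mulVec {d : ℕ} (g y : Fin d → ℝ) :
    y ⬝ᵥ (vecMulVec g g *ᵥ y) = (g ⬝ᵥ y) ^ 2 := by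
  rw [vecMulVec_mulVec]
  simp [dotProduct_smul, dotProduct_comm y g, sq]

/-- The total shrinkage of Frequent Directions is controlled by the spectral tail. -/
theorem sum_shrinkage_mul_le_tailEigs {m d : ℕ} {T : ℕ} {S V : ℕ → Matrix (Fin m) (Fin d) ℝ}
    {ρ : ℕ → ℝ} {g : ℕ → Fin d → ℝ} (hS0 : S 0 = 0) (hV : ∀ t < T, V t * (V t)ᵀ = 1)
    (hρ : ∀ t < T, 0 ≤ ρ t)
    (hS : ∀ t < T, (S (t + 1))ᵀ * S (t + 1) + ρ t • ((V t)ᵀ * V t) =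
      (S t)ᵀ * S t + vecMulVec (g (t + 1)) (g (t + 1))) (k : ℕ) :
    (∑ t ∈ Finset.range T, ρ t) * ((m : ℝ) - k) ≤
      tailEigs (of fun t : Fin T => g (t + 1)) k := by
  set G : Matrix (Fin T) (Fin d) ℝ := of fun t => g (t + 1) with hG
  -- Telescoping the sketch identity gives `∑ ρ_t V_tᵀV_t = GᵀG - S_TᵀS_T` as quadratic forms.
  have hquad : ∀ y, ∑ t ∈ Finset.range T, ρ t * ((V t *ᵥ y) ⬝ᵥ (V t *ᵥ y)) ≤
      (G *ᵥ y) ⬝ᵥ (G *ᵥ y) := fun y => by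
    have hGy : (G *ᵥ y) ⬝ᵥ (G *ᵥ y) = ∑ t ∈ Finset.range T, (g (t + 1) ⬝ᵥ y) ^ 2 := by
      rw [← Fin.sum_univ_eq_sum_range fun t => (g (t + 1) ⬝ᵥ y) ^ 2]
      exact Finset.sum_congr rfl fun t _ => (sq _).symm
    have hstep : ∀ t ∈ Finset.range T, ρ t * ((V t *ᵥ y) ⬝ᵥ (V t *ᵥ y)) =
        (g (t + 1) ⬝ᵥ y) ^ 2 -
          ((S (t + 1) *ᵥ y) ⬝ᵥ (S (t + 1) *ᵥ y) - (S t *ᵥ y) ⬝ᵥ (S t *ᵥ y)) := fun t ht => by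
      have h := congrArg (fun M => y ⬝ᵥ (M *ᵥ y)) (hS t (Finset.mem_range.1 ht))
      simp only [add_mulVec, smul_mulVec, dotProduct_add, dotProduct_smul, smul_eq_mul,
        dotProduct_mulVec_gram, dotProduct_vecMulVec_mulVec] at h
      linarith
    rw [Finset.sum_congr rfl hstep, Finset.sum_sub_distrib, ← hGy,
      Finset.sum_range_sub fun t => (S t *ᵥ y) ⬝ᵥ (S t *ᵥ y), hS0]
    have := real_dotProduct_self_nonneg (S T *ᵥ y)
    simp
    linarith
  obtain ⟨p, hp, hpp, hpe⟩ := exists_eigenbasis_gram G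
  calc (∑ t ∈ Finset.range T, ρ t) * ((m : ℝ) - k)
      = ∑ t ∈ Finset.range T, ρ t * ((m : ℝ) - k) := Finset.sum_mul _ _ _
    _ ≤ ∑ t ∈ Finset.range T, ρ t * ∑ i with k ≤ i.val, (V t *ᵥ p i) ⬝ᵥ (V t *ᵥ p i) :=
        Finset.sum_le_sum fun t ht => mul_le_mul_of_nonneg_left
          (le_sum_mulVec_tail (hV t (Finset.mem_range.1 ht)) p hp hpp k)
          (hρ t (Finset.mem_range.1 ht))
    _ = ∑ i with k ≤ i.val, ∑ t ∈ Finset.range T, ρ t * ((V t *ᵥ p i) ⬝ᵥ (V t *ᵥ p i)) := by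
        simp only [Finset.mul_sum]
        exact Finset.sum_comm
    _ ≤ tailEigs G k := Finset.sum_le_sum fun i _ => (hquad _).trans_eq (hpe i)

/-! ### Analysis of one round -/

variable {m d : ℕ} [NeZero m] {α : ℝ}

/-- The potential bound for one round: `gᵀ A⁻¹ g` is controlled by the increase of `log det` and
the shrinkage. -/
theorem IsSketch.dotProduct_precondInv_le_log_det {S S' V : Matrix (Fin m) (Fin d) ℝ}
    {H' : Matrix (Fin m) (Fin m) ℝ} {g : Fin d → ℝ} {ρ : ℝ} (h : IsSketch α S' H') (hα : 0 < α)
    (hV : V * Vᵀ = 1) (hρ : 0 ≤ ρ) (hS : S'ᵀ * S' + ρ • (Vᵀ * V) = Sᵀ * S + vecMulVec g g) :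
    g ⬝ᵥ (precondInv α S' H' *ᵥ g) ≤
      Real.log (precond α S').det - Real.log (precond α S).det + m / α * ρ := by
  set N := precondInv α S' H' with hN
  have h1 := trace_mul_sub_le_log_det (precond_posDef (S := S') hα) (precond_posDef (S := S) hα)
    (h.precond_mul_precondInv hα)
  have h2 : vecMulVec g g = (precond α S' - precond α S) + ρ • (Vᵀ * V) := by
    rw [precond, precond, add_sub_add_left_eq_sub, sub_add_eq_add_sub, hS, add_sub_cancel_left]
  have h3 : (N * vecMulVec g g).trace = g ⬝ᵥ (N *ᵥ g) := by
    rw [mul_vecMulVec, trace_vecMulVec, dotProduct_comm]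
  -- The trace adds up `N` on the `m` unit rows of `V`, and `N ≤ I/α`.
  have h4 : (N * (Vᵀ * V)).trace ≤ m / α := by
    have h5 : (N * (Vᵀ * V)).trace = ∑ i, V i ⬝ᵥ (N *ᵥ V i) := by
      rw [← Matrix.mul_assoc, trace_mul_comm]
      refine Finset.sum_congr rfl fun i _ => ?_
      rw [diag_apply, mul_apply]
      rfl
    have h6 : ∀ i, V i ⬝ᵥ (N *ᵥ V i) ≤ 1 / α := fun i => by
      have h7 : V i ⬝ᵥ V i = 1 := by
        have := congrFun (congrFun hV i) i
        rwa [one_apply_eq] at this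
      rw [← h7]
      exact h.dotProduct_precondInv_le hα _
    rw [h5]
    refine (Finset.sum_le_sum fun i _ => h6 i).trans_eq ?_
    simp [div_eq_mul_inv]
  rw [← h3, h2, Matrix.mul_add, trace_add, Matrix.mul_smul, trace_smul, smul_eq_mul]
  have := mul_le_mul_of_nonneg_left h4 hρ
  linarith

namespace IsRun

variable {T : ℕ} {C L : ℝ} {x : ℕ → Fin d → ℝ} {ℓ : ℕ → ℝ → ℝ} {σs η : ℕ → ℝ}
  {u w : ℕ → Fin d → ℝ} {S : ℕ → Matrix (Fin m) (Fin d) ℝ} {H : ℕ → Matrix (Fin m) (Fin m) ℝ}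

theorem isSketch (h : IsRun T C α x ℓ σs η u w S H) : ∀ t ≤ T, IsSketch α (S t) (H t)
  | 0, _ => by rw [h.init_S, h.init_H]; exact isSketch_zero
  | t + 1, ht => ((h.isSketch t (by omega)).update (h.sketch t (by omega))).1

theorem exists_shrinkage (h : IsRun T C α x ℓ σs η u w S H) :
    ∃ (V : ℕ → Matrix (Fin m) (Fin d) ℝ) (ρ : ℕ → ℝ), ∀ t < T, V t * (V t)ᵀ = 1 ∧ 0 ≤ ρ t ∧
      (S (t + 1))ᵀ * S (t + 1) + ρ t • ((V t)ᵀ * V t) = (S t)ᵀ * S t +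
        vecMulVec (toSketch x ℓ σs η w (t + 1)) (toSketch x ℓ σs η w (t + 1)) := by
  have key : ∀ t, ∃ (V : Matrix (Fin m) (Fin d) ℝ) (ρ : ℝ), t < T → V * Vᵀ = 1 ∧ 0 ≤ ρ ∧
      (S (t + 1))ᵀ * S (t + 1) + ρ • (Vᵀ * V) = (S t)ᵀ * S t +
        vecMulVec (toSketch x ℓ σs η w (t + 1)) (toSketch x ℓ σs η w (t + 1)) := fun t => by
    by_cases ht : t < T
    · obtain ⟨V, ρ, hVρ⟩ := ((h.isSketch t ht.le).update (h.sketch t ht)).2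
      exact ⟨V, ρ, fun _ => hVρ⟩
    -- Arbitrary values outside the horizon make the choice total.
    · exact ⟨0, 0, fun ht' => absurd ht' ht⟩
  choose V ρ hVρ using key
  exact ⟨V, ρ, hVρ⟩

/-- One round of the online Newton analysis. -/
theorem two_mul_sub_le (h : IsRun T C α x ℓ σs η u w S H) (hα : 0 < α) (hC : 0 ≤ C) {t : ℕ}
    (ht : t < T) {v : Fin d → ℝ} (hv : v ∈ comparators C T x)
    (hdiff : Differentiable ℝ (ℓ (t + 1))) (hLip : ScalarLipschitz C L (ℓ (t + 1)))
    (hCurv : Curvature (slab C (x (t + 1))) (comparators C T x)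
      (linLoss (ℓ (t + 1)) (x (t + 1))) (σs (t + 1)))
    (hη : 0 ≤ η (t + 1)) {δ : ℝ} (hδ : 0 < δ) (hδ_le : δ ≤ σs (t + 1) + η (t + 1))
    {V : Matrix (Fin m) (Fin d) ℝ} {ρ : ℝ} (hV : V * Vᵀ = 1) (hρ : 0 ≤ ρ)
    (hS : (S (t + 1))ᵀ * S (t + 1) + ρ • (Vᵀ * V) = (S t)ᵀ * S t +
      vecMulVec (toSketch x ℓ σs η w (t + 1)) (toSketch x ℓ σs η w (t + 1))) :
    2 * (linLoss (ℓ (t + 1)) (x (t + 1)) (w (t + 1)) - linLoss (ℓ (t + 1)) (x (t + 1)) v) ≤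
      (u (t + 1) - v) ⬝ᵥ (precond α (S t) *ᵥ (u (t + 1) - v))
        - (u (t + 2) - v) ⬝ᵥ (precond α (S (t + 1)) *ᵥ (u (t + 2) - v))
        + 4 * (C * L) ^ 2 * η (t + 1)
        + (Real.log (precond α (S (t + 1))).det - Real.log (precond α (S t)).det
          + m / α * ρ) / δ := by
  have hsk := h.isSketch t ht.le
  have hsk' := h.isSketch (t + 1) ht
  have hpos : 0 < σs (t + 1) + η (t + 1) := hδ.trans_le hδ_le
  have hvx : v ∈ slab C (x (t + 1)) := hv (t + 1) (Finset.mem_Icc.2 ⟨by omega, ht⟩)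
  have hwx : w (t + 1) ∈ slab C (x (t + 1)) := by
    rw [h.proj t ht]
    exact hsk.projStep_mem_slab hα hC _ _
  have hproj := hsk.projStep_quadForm_le hα hvx (u (t + 1))
  rw [← h.proj t ht] at hproj
  have hcurv := hCurv _ hwx _ hv
  rw [grad_linLoss hdiff] at hcurv
  have hpot := hsk'.dotProduct_precondInv_le_log_det hα hV hρ hS
  have hquad := congrArg (fun M => (w (t + 1) - v) ⬝ᵥ (M *ᵥ (w (t + 1) - v))) hS
  simp only [add_mulVec, smul_mulVec, dotProduct_add, dotProduct_smul, smul_eq_mul,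
    dotProduct_mulVec_gram, dotProduct_vecMulVec_mulVec] at hquad
  have hVnn := mul_nonneg hρ (real_dotProduct_self_nonneg (V *ᵥ (w (t + 1) - v)))
  -- Both predictions lie in `[-C, C]`, so they differ by at most `2C`.
  have hgy : (roundGrad x ℓ w (t + 1) ⬝ᵥ (w (t + 1) - v)) ^ 2 ≤ 4 * (C * L) ^ 2 := by
    have h1 : |roundGrad x ℓ w (t + 1) ⬝ᵥ (w (t + 1) - v)| ≤ L * (C + C) := by
      rw [roundGrad, smul_dotProduct, smul_eq_mul, abs_mul, dotProduct_comm (x (t + 1)),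
        sub_dotProduct]
      have h2 := hLip _ hwx
      exact mul_le_mul h2 ((abs_sub _ _).trans (add_le_add hwx hvx)) (abs_nonneg _)
        ((abs_nonneg _).trans h2)
    have h3 := pow_le_pow_left₀ (abs_nonneg _) h1 2
    rw [sq_abs] at h3
    linarith
  have hu : u (t + 2) - v = (w (t + 1) - v) -
      (1 : ℝ) • (precondInv α (S (t + 1)) (H (t + 1)) *ᵥ roundGrad x ℓ w (t + 1)) := by
    rw [h.weight t ht, precondInv_mulVec, one_smul, sub_right_comm]
  have hnewton := hsk'.quadForm_sub hα 1 (roundGrad x ℓ w (t + 1)) (w (t + 1) - v)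
  rw [← hu] at hnewton
  have hneg : roundGrad x ℓ w (t + 1) ⬝ᵥ (v - w (t + 1)) =
      -(roundGrad x ℓ w (t + 1) ⬝ᵥ (w (t + 1) - v)) := by
    rw [← dotProduct_neg, neg_sub]
  change linLoss (ℓ (t + 1)) (x (t + 1)) (w (t + 1)) + roundGrad x ℓ w (t + 1) ⬝ᵥ (v - w (t + 1))
    + σs (t + 1) / 2 * (roundGrad x ℓ w (t + 1) ⬝ᵥ (w (t + 1) - v)) ^ 2 ≤ _ at hcurv
  rw [hneg] at hcurv
  rw [dotProduct_precond_mulVec (w (t + 1) - v)] at hproj hnewton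
  simp only [toSketch, smul_dotProduct, mulVec_smul, dotProduct_smul, smul_eq_mul, mul_pow,
    Real.sq_sqrt hpos.le] at hpot hquad
  rw [← mul_assoc, Real.mul_self_sqrt hpos.le] at hpot
  -- Nonnegativity permits replacing `σ_t + η_t` by the smaller `δ`.
  have hNnn : 0 ≤ roundGrad x ℓ w (t + 1) ⬝ᵥ
      (precondInv α (S (t + 1)) (H (t + 1)) *ᵥ roundGrad x ℓ w (t + 1)) := by
    by_cases hg : roundGrad x ℓ w (t + 1) = 0
    · simp [hg]
    · exact (hsk'.dotProduct_precondInv_pos hα hg).le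
  have hN : roundGrad x ℓ w (t + 1) ⬝ᵥ
      (precondInv α (S (t + 1)) (H (t + 1)) *ᵥ roundGrad x ℓ w (t + 1)) ≤
      (Real.log (precond α (S (t + 1))).det - Real.log (precond α (S t)).det
          + m / α * ρ) / δ := by
    rw [le_div_iff₀ hδ, mul_comm]
    exact (mul_le_mul_of_nonneg_right hδ_le hNnn).trans hpot
  have hηgy := mul_le_mul_of_nonneg_left hgy hη
  linarith

end IsRun

end FDSON

end

/-! ### Summation over the rounds -/

theorem theorem3 {d m : ℕ} [NeZero m] (hmd : m ≤ d) (T : ℕ) (C L α σ : ℝ)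
    (hC : 0 ≤ C) (hα : 0 < α) (hσ : 0 ≤ σ)
    (x : ℕ → Fin d → ℝ) (ℓ : ℕ → ℝ → ℝ) (σs η : ℕ → ℝ)
    (hℓ_nonneg : ∀ t ∈ Finset.Icc 1 T, ∀ z, 0 ≤ ℓ t z)
    (hℓ_conv : ∀ t ∈ Finset.Icc 1 T, ConvexOn ℝ Set.univ (ℓ t))
    (hℓ_diff : ∀ t ∈ Finset.Icc 1 T, Differentiable ℝ (ℓ t))
    (hLip : ∀ t ∈ Finset.Icc 1 T, FDSON.ScalarLipschitz C L (ℓ t))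
    (hCurv : ∀ t ∈ Finset.Icc 1 T, FDSON.Curvature (FDSON.slab C (x t))
      (FDSON.comparators C T x) (FDSON.linLoss (ℓ t) (x t)) (σs t))
    (hσs : ∀ t ∈ Finset.Icc 1 T, σ ≤ σs t)
    (hη_nonneg : ∀ t ∈ Finset.Icc 1 T, 0 ≤ η t)
    (hη_anti : AntitoneOn η (Set.Icc 1 T))
    (hpos : 0 < σ + η T)
    (u w : ℕ → Fin d → ℝ) (S : ℕ → Matrix (Fin m) (Fin d) ℝ)
    (H : ℕ → Matrix (Fin m) (Fin m) ℝ)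
    (hrun : FDSON.IsRun T C α x ℓ σs η u w S H)
    (v : Fin d → ℝ) (hv : v ∈ FDSON.comparators C T x) (k : ℕ) (hk : k < m) :
    FDSON.regret T x ℓ w v ≤
      α / 2 * (v ⬝ᵥ v) + 2 * (C * L) ^ 2 * ∑ t ∈ Finset.Icc 1 T, η t
        + m / (2 * (σ + η T)) * Real.log (1 + ((S T)ᵀ * S T).trace / (m * α))
        + m * FDSON.tailEigs (FDSON.gradMatrix T x ℓ σs η w) k
            / (2 * ((m : ℝ) - k) * (σ + η T) * α) := by
  obtain ⟨V, ρ, hVρ⟩ := hrun.exists_shrinkage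
  have hIcc : ∀ t < T, t + 1 ∈ Finset.Icc 1 T := fun t ht => Finset.mem_Icc.2 ⟨by omega, ht⟩
  have hδ : ∀ t < T, σ + η T ≤ σs (t + 1) + η (t + 1) := fun t ht =>
    add_le_add (hσs _ (hIcc t ht)) (hη_anti ⟨by omega, ht⟩ ⟨by omega, le_rfl⟩ ht)
  have hround := Finset.sum_le_sum fun t (ht : t ∈ Finset.range T) =>
    have ht := Finset.mem_range.1 ht
    hrun.two_mul_sub_le hα hC ht hv (hℓ_diff _ (hIcc t ht)) (hLip _ (hIcc t ht))
      (hCurv _ (hIcc t ht)) (hη_nonneg _ (hIcc t ht)) hpos (hδ t ht) (hVρ t ht).1 (hVρ t ht).2.1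
      (hVρ t ht).2.2
  -- The potential telescopes; as `u 1 = 0` and `S 0 = 0`, its initial value is `α‖v‖²`.
  rw [← Finset.mul_sum, Finset.sum_sub_distrib, Finset.sum_add_distrib, Finset.sum_add_distrib,
    Finset.sum_range_sub' fun t => (u (t + 1) - v) ⬝ᵥ (FDSON.precond α (S t) *ᵥ (u (t + 1) - v)),
    ← Finset.mul_sum, ← Finset.sum_div, Finset.sum_add_distrib, ← Finset.mul_sum,
    Finset.sum_range_sub fun t => Real.log (FDSON.precond α (S t)).det, hrun.init_S,
    zero_add, hrun.init_u, zero_sub, FDSON.dotProduct_precond_mulVec,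
    FDSON.dotProduct_precond_mulVec] at hround
  have hdet := (hrun.isSketch T le_rfl).log_det_precond_le hα
  have htail := FDSON.sum_shrinkage_mul_le_tailEigs hrun.init_S (fun t ht => (hVρ t ht).1)
    (fun t ht => (hVρ t ht).2.1) (fun t ht => (hVρ t ht).2.2) k
  change _ ≤ FDSON.tailEigs (FDSON.gradMatrix T x ℓ σs η w) k at htail
  have hmk : (0 : ℝ) < m - k := sub_pos.2 (by exact_mod_cast hk)
  rw [← le_div_iff₀ hmk] at htail
  have hfinal : (Real.log (FDSON.precond α (S T)).det
      - Real.log (FDSON.precond α (0 : Matrix (Fin m) (Fin d) ℝ)).det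
        + m / α * ∑ t ∈ Finset.range T, ρ t) / (σ + η T) ≤
      (m * Real.log (1 + ((S T)ᵀ * S T).trace / (m * α))
        + m / α * (FDSON.tailEigs (FDSON.gradMatrix T x ℓ σs η w) k / (m - k))) / (σ + η T) := by
    gcongr
  -- The final potential is nonnegative and is dropped.
  have hnn := FDSON.real_dotProduct_self_nonneg (S T *ᵥ (u (T + 1) - v))
  have hnn' := mul_nonneg hα.le (FDSON.real_dotProduct_self_nonneg (u (T + 1) - v))
  have hsplit : (m * Real.log (1 + ((S T)ᵀ * S T).trace / (m * α))
        + m / α * (FDSON.tailEigs (FDSON.gradMatrix T x ℓ σs η w) k / (m - k))) / (σ + η T) =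
      2 * (m / (2 * (σ + η T)) * Real.log (1 + ((S T)ᵀ * S T).trace / (m * α))
        + m * FDSON.tailEigs (FDSON.gradMatrix T x ℓ σs η w) k
            / (2 * ((m : ℝ) - k) * (σ + η T) * α)) := by
    have := hmk.ne'
    have := hpos.ne'
    field_simp
  simp only [zero_mulVec, dotProduct_zero, add_zero, neg_dotProduct, dotProduct_neg,
    neg_neg] at hround
  rw [FDSON.regret, FDSON.sum_Icc_one_eq_sum_range, FDSON.sum_Icc_one_eq_sum_range,
    FDSON.sum_Icc_one_eq_sum_range]
  linarith
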